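/- Let $q\ge 2$ be an integer and let $X$ be a $(q+1)$-regular tree with edges of length $1$, with path metric $d$ on its vertex set, set of oriented edges $E$ (each geometric edge gives two oriented edges; $o(e)$ and $t(e)$ denote the origin and the target of $e$), and visual boundary $\partial X$, the set of asymptotic classes of geodesic rays. For vertices $x,z$ let $\Omega_x(z)\subset\partial X$ be the set of $\xi$ such that $z$ lies on the geodesic ray from $x$ to $\xi$; these sets generate the (compact) topology of $\partial X$. For a vertex $x$ let $\nu_x$ be the Borel probability measure on $\partial X$ with $\nu_x(\Omega_x(z))=\frac{1}{q^{n-1}(q+1)}$ for every vertex $z$ with $d(x,z)=n\ge 1$. For $e\in E$ let $$\nu_e^+=\tfrac{q+1}{q}\,\nu_{o(e)}|_{\Omega_{t(e)}(o(e))},\qquad \nu_e^-=(q+1)\,\nu_{o(e)}|_{\Omega_{o(e)}(t(e))},\qquad \nu_e=\nu_e^+-\nu_e^-.$$ The Poisson transform of a continuous function $\phi:\partial X\to\mathbb C$ is $\mathcal P\phi:E\to\mathbb C$, $\mathcal P\phi(e)=\int_{\partial X}\phi\,d\nu_e$; it vanishes on constant functions, hence is defined on $C(\partial X)/\mathbb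 C$. The Busemann cocycle is the continuous function $B(x,y)(\xi)=\lim_{z\to\xi}\big(d(y,z)-d(x,z)\big)$ on $\partial X$, and $\mathbf B(x,y)$ denotes its class in $C(\partial X)/\mathbb C$. Theorem. For every integer $q\ge 2$ there are constants $C,K>0$, namely $$C=\frac{8(q+1)^2}{(q-1)^2},\qquad K=\frac{16q^2(2q+1)}{(q-1)^3(q+1)},$$ such that for every $(q+1)$-regular tree $X$ and all vertices $x,y$ of $X$, the function $\mathcal P\mathbf B(x,y)$ belongs to $\ell^2(E)$ and $$4\,d(x,y)\le \|\mathcal P\mathbf B(x,y)\|_{\ell^2(E)}^2\le C\,d(x,y)+K .$$ -/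

import Mathlib

open Filter Topology MeasureTheory
open scoped ENNReal NNReal

namespace RegularTree

open SimpleGraph

variable {V : Type*} {G : SimpleGraph V}

theorem eq_of_adj_of_dist (hT : G.IsTree) {v b b' c : V} (h : G.Adj b c) (h' : G.Adj b' c)
    (hd : G.dist v c = G.dist v b + 1) (hd' : G.dist v c = G.dist v b' + 1) : b = b' := by
  obtain ⟨p, hp⟩ := hT.connected.exists_walk_length_eq_dist v b
  obtain ⟨p', hp'⟩ := hT.connected.exists_walk_length_eq_dist v b'
  have h1 : (p.concat h).IsPath := Walk.isPath_of_length_eq_dist _ (by simp [hp, hd])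
  have h2 : (p'.concat h').IsPath := Walk.isPath_of_length_eq_dist _ (by simp [hp', hd'])
  have := congrArg (fun q : G.Path v c => q.1.penultimate)
    ((hT.isAcyclic.subsingleton_path v c).elim ⟨_, h1⟩ ⟨_, h2⟩)
  simpa using this

theorem exists_adj_dist (hT : G.IsTree) {v c : V} (h : v ≠ c) :
    ∃ b, G.Adj b c ∧ G.dist v c = G.dist v b + 1 := by
  obtain ⟨p, hp⟩ := hT.connected.exists_walk_length_eq_dist v c
  have hnil : ¬ p.Nil := Walk.not_nil_of_ne h
  refine ⟨p.penultimate, p.adj_penultimate hnil, ?_⟩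
  have h1 : G.dist v p.penultimate ≤ p.dropLast.length := dist_le _
  have h2 : p.dropLast.length + 1 = p.length := by
    simp [Walk.dropLast, Walk.take_length]
    have := Walk.not_nil_iff_lt_length.1 hnil
    omega
  have h3 := hT.connected.dist_triangle (u := v) (v := p.penultimate) (w := c)
  rw [dist_eq_one_iff_adj.2 (p.adj_penultimate hnil)] at h3
  omega

theorem dist_across (hT : G.IsTree) {x y : V} : ∀ (n : ℕ) {a b : V}, G.Adj a b →
    G.dist y b = n → G.dist x b = G.dist x a + 1 → G.dist y a = n + 1 →
    G.dist x y = G.dist x a + 1 + n := by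
  intro n
  induction n with
  | zero =>
    intro a b hab hb hx _
    rw [hT.connected.dist_eq_zero_iff.1 hb]; omega
  | succ n ih =>
    intro a b hab hb hx ha
    have hne : y ≠ b := by rintro rfl; simp at hb
    obtain ⟨c, hc, hcd⟩ := exists_adj_dist hT hne
    have hxc : G.dist x c = G.dist x b + 1 := by
      rcases hT.dist_eq_dist_add_one_of_adj x hc with h | h
      · exact h
      · have := eq_of_adj_of_dist hT hab hc hx h
        subst this; omega
    have := ih hc.symm (by omega) hxc (by omega)
    omega

/-- If `w` lies on `[x, z]` and is at least as far from `x` as `y` is, then it lies on `[y, z]`. -/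
theorem dist_eq_of_le (hT : G.IsTree) {x y w : V} (hw : G.dist x y ≤ G.dist x w) :
    ∀ (n : ℕ) {z : V}, G.dist w z = n → G.dist x z = G.dist x w + G.dist w z →
    G.dist y z = G.dist y w + G.dist w z := by
  intro n
  induction n with
  | zero => intro z hz _; rw [hT.connected.dist_eq_zero_iff.1 hz]; simp
  | succ n ih =>
    intro z hz hx
    have hne : w ≠ z := by rintro rfl; simp at hz
    obtain ⟨c, hc, hcd⟩ := exists_adj_dist hT hne
    have h1 := hT.connected.dist_triangle (u := x) (v := w) (w := c)
    have h2 := hT.connected.dist_triangle (u := x) (v := c) (w := z)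
    rw [dist_eq_one_iff_adj.2 hc] at h2
    have h3 := ih (z := c) (by omega) (by omega)
    rcases hT.dist_eq_dist_add_one_of_adj y hc with h | h
    · have := dist_across hT (x := x) (y := y) (G.dist y z) hc rfl (by omega) h
      omega
    · omega

theorem eq_of_between (hT : G.IsTree) {a v v' : V} (hd : G.dist a v = G.dist a v') :
    ∀ (n : ℕ) {b : V}, G.dist v b = n → G.dist a b = G.dist a v + G.dist v b →
    G.dist a b = G.dist a v' + G.dist v' b → v = v' := by
  intro n
  induction n with
  | zero =>
    intro b hb h h'
    rw [hT.connected.dist_eq_zero_iff.1 hb]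
    exact (hT.connected.dist_eq_zero_iff.1 (by omega)).symm
  | succ n ih =>
    intro b hb h h'
    have hne : v ≠ b := by rintro rfl; simp at hb
    have hne' : v' ≠ b := by rintro rfl; simp at h'; omega
    obtain ⟨c, hc, hcd⟩ := exists_adj_dist hT hne
    obtain ⟨c', hc', hcd'⟩ := exists_adj_dist hT hne'
    have t1 := hT.connected.dist_triangle (u := a) (v := v) (w := c)
    have t2 := hT.connected.dist_triangle (u := a) (v := c) (w := b)
    have t1' := hT.connected.dist_triangle (u := a) (v := v') (w := c')
    have t2' := hT.connected.dist_triangle (u := a) (v := c') (w := b)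
    rw [dist_eq_one_iff_adj.2 hc] at t2
    rw [dist_eq_one_iff_adj.2 hc'] at t2'
    have := eq_of_adj_of_dist hT (v := a) hc hc' (by omega) (by omega)
    subst this
    exact ih (b := c) (by omega) (by omega) (by omega)

end RegularTree

namespace RegularTree

open SimpleGraph

variable {V : Type*}

/-- A geodesic ray of `G` (an isometric embedding of `ℕ` into the vertices). -/
structure Ray (G : SimpleGraph V) where
  toFun : ℕ → V
  dist_eq : ∀ m n, G.dist (toFun m) (toFun (m + n)) = n

instance (G : SimpleGraph V) : CoeFun (Ray G) (fun _ => ℕ → V) := ⟨Ray.toFun⟩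

/-- Two rays are asymptotic if they stay at bounded distance from each other. -/
def Ray.setoid (G : SimpleGraph V) : Setoid (Ray G) where
  r r s := ∃ C : ℕ, ∀ n, G.edist (r n) (s n) ≤ C
  iseqv :=
    { refl := fun r => ⟨0, fun n => by simp⟩
      symm := fun ⟨C, h⟩ => ⟨C, fun n => by rw [edist_comm]; exact h n⟩
      trans := fun ⟨C, h⟩ ⟨D, k⟩ => ⟨C + D, fun n => by
        push_cast
        exact SimpleGraph.edist_triangle.trans (add_le_add (h n) (k n))⟩ }

/-- The visual boundary: asymptotic classes of geodesic rays. -/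
def Boundary (G : SimpleGraph V) : Type _ := Quotient (Ray.setoid G)

variable {G : SimpleGraph V}

/-- The end point of a ray in the boundary. -/
def Ray.endpoint (r : Ray G) : Boundary G := Quotient.mk (Ray.setoid G) r

variable (G) in
/-- The shadow `Ω_x(z)`: the boundary points `ξ` such that `z` lies on a geodesic ray
from `x` to `ξ`. -/
def shadow (x z : V) : Set (Boundary G) :=
  {ξ | ∃ r : Ray G, r 0 = x ∧ r.endpoint = ξ ∧ ∃ n, r n = z}

/-- The cone topology on the boundary, generated by the shadows. -/
instance : TopologicalSpace (Boundary G) :=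
  TopologicalSpace.generateFrom (Set.range fun p : V × V => shadow G p.1 p.2)

instance : MeasurableSpace (Boundary G) := borel _

instance : BorelSpace (Boundary G) := ⟨rfl⟩

/-- The vertices `z` such that `w` lies on the geodesic from `x` to `z`. -/
def cone (G : SimpleGraph V) (x w : V) : Set V := {z | G.dist x z = G.dist x w + G.dist w z}

/-- The filter on the vertices describing convergence `z → ξ` to a boundary point in the cone
topology. -/
def towards (ξ : Boundary G) : Filter V :=
  ⨅ (x : V) (w : V) (_ : ξ ∈ shadow G x w), 𝓟 (cone G x w)

/-- `B(x,y)(ξ) = lim_{z → ξ} d(y,z) - d(x,z)`. -/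
noncomputable def busemannFun (G : SimpleGraph V) (x y : V) (ξ : Boundary G) : ℝ :=
  limUnder (towards ξ) fun z => (G.dist y z : ℝ) - G.dist x z

theorem Ray.dist_of_le (r : Ray G) {m n : ℕ} (h : m ≤ n) : G.dist (r m) (r n) = n - m := by
  obtain ⟨k, rfl⟩ := Nat.exists_eq_add_of_le h
  rw [r.dist_eq]; omega

theorem Ray.dist_zero (r : Ray G) (n : ℕ) : G.dist (r 0) (r n) = n := by
  rw [r.dist_of_le (Nat.zero_le n)]; omega

theorem Ray.adj (r : Ray G) (n : ℕ) : G.Adj (r n) (r (n + 1)) :=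
  dist_eq_one_iff_adj.1 (r.dist_eq n 1)

theorem Ray.endpoint_eq_iff (hG : G.Connected) {r s : Ray G} :
    r.endpoint = s.endpoint ↔ ∃ C : ℕ, ∀ n, G.dist (r n) (s n) ≤ C := by
  refine (Quotient.eq (r := Ray.setoid G)).trans ?_
  refine exists_congr fun C => forall_congr' fun n => ?_
  rw [← (hG (r n) (s n)).coe_dist_eq_edist]
  exact Nat.cast_le

theorem exists_ray_rep (ξ : Boundary G) : ∃ r : Ray G, r.endpoint = ξ := Quotient.exists_rep ξ

/-- Vertex sequences whose consecutive terms are adjacent and which leave their origin at unit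
speed are geodesic rays. -/
def Ray.mk' (hG : G.Connected) (p : ℕ → V) (hadj : ∀ n, G.Adj (p n) (p (n + 1)))
    (hd : ∀ n, G.dist (p 0) (p n) = n) : Ray G where
  toFun := p
  dist_eq m n := by
    have h1 : ∀ n, G.dist (p m) (p (m + n)) ≤ n := by
      intro n
      induction n with
      | zero => simp
      | succ n ih =>
        have := hG.dist_triangle (u := p m) (v := p (m + n)) (w := p (m + n + 1))
        rw [dist_eq_one_iff_adj.2 (hadj (m + n))] at this
        rw [← add_assoc]; omega
    have h2 := hG.dist_triangle (u := p 0) (v := p m) (w := p (m + n))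
    rw [hd, hd] at h2
    have := h1 n
    omega

/-- Beyond `r N`, the distance to `y` grows at unit speed along the ray `r`. -/
theorem Ray.dist_add (hT : G.IsTree) (r : Ray G) (y : V) {N n : ℕ} (hN : G.dist (r 0) y ≤ N)
    (hn : N ≤ n) : G.dist y (r n) = G.dist y (r N) + (n - N) := by
  have := dist_eq_of_le hT (x := r 0) (y := y) (w := r N) (by rwa [r.dist_zero]) _
    (z := r n) rfl (by rw [r.dist_zero, r.dist_zero, r.dist_of_le hn]; omega)
  rw [this, r.dist_of_le hn]

theorem Ray.merge (hT : G.IsTree) {r s : Ray G} (h : r.endpoint = s.endpoint) {n : ℕ}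
    (hn : G.dist (r 0) (s 0) ≤ n) : r n = s (G.dist (s 0) (r n)) := by
  obtain ⟨C, hC⟩ := (Ray.endpoint_eq_iff hT.connected).1 h
  set m := n + C + G.dist (s 0) (r n) with hm
  have e1 := hC m
  have e2 : G.dist (r n) (r m) = m - n := r.dist_of_le (by omega)
  have e3 := dist_eq_of_le hT (x := r m) (y := s m) (w := r n) (z := r 0)
    (by rw [SimpleGraph.dist_comm (v := r n), e2]; omega) _ rfl (by
      rw [SimpleGraph.dist_comm (v := r n), e2, SimpleGraph.dist_comm, SimpleGraph.dist_comm (v := r 0), r.dist_zero, r.dist_zero]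
      omega)
  have e4 := dist_eq_of_le hT (x := r 0) (y := s 0) (w := r n) (z := s m)
    (by rwa [r.dist_zero]) _ rfl (by
      rw [SimpleGraph.dist_comm, e3, SimpleGraph.dist_comm (v := r n), SimpleGraph.dist_comm (u := r n) (v := r 0)]; omega)
  refine eq_of_between hT (a := s 0) ?_ _ (b := s m) rfl e4 ?_
  · rw [s.dist_zero]
  · rw [s.dist_zero, s.dist_zero, s.dist_of_le (by omega)]; omega

/-- Every boundary point is the end point of a ray issued from a given vertex. -/
theorem exists_ray (hT : G.IsTree) (y : V) (ξ : Boundary G) :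
    ∃ s : Ray G, s 0 = y ∧ s.endpoint = ξ := by
  obtain ⟨r, rfl⟩ := exists_ray_rep ξ
  set N := G.dist (r 0) y with hN
  set M := G.dist y (r N) with hM
  obtain ⟨w, hw⟩ := hT.connected.exists_walk_length_eq_dist y (r N)
  have hwl : w.length = M := hw
  let p : ℕ → V := fun n => if n ≤ M then w.getVert n else r (N + (n - M))
  have hp1 : ∀ n ≤ M, p n = w.getVert n := fun n hn => if_pos hn
  have hp2 : ∀ n, M ≤ n → p n = r (N + (n - M)) := by
    intro n hn
    rcases hn.eq_or_lt with rfl | hn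
    · rw [hp1 _ le_rfl, ← hwl, w.getVert_length]; simp
    · exact if_neg (by omega)
  have hadj : ∀ n, G.Adj (p n) (p (n + 1)) := by
    intro n
    rcases lt_or_ge n M with h | h
    · rw [hp1 n h.le, hp1 (n + 1) h]
      exact w.adj_getVert_succ (by omega)
    · rw [hp2 n h, hp2 (n + 1) (by omega)]
      have := r.adj (N + (n - M))
      rwa [show N + (n + 1 - M) = N + (n - M) + 1 by omega]
  have hp0 : p 0 = y := by rw [hp1 0 (Nat.zero_le _)]; simp
  have hd : ∀ n, G.dist (p 0) (p n) = n := by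
    intro n
    rw [hp0]
    rcases le_total n M with h | h
    · rw [hp1 n h]
      have h1 : G.dist y (w.getVert n) ≤ n := by
        have := dist_le (w.take n)
        rw [Walk.take_length] at this
        omega
      have h2 : G.dist (w.getVert n) (r N) ≤ M - n := by
        have := dist_le (w.drop n)
        rw [Walk.drop_length] at this
        omega
      have h3 := hT.connected.dist_triangle (u := y) (v := w.getVert n) (w := r N)
      omega
    · rw [hp2 n h, r.dist_add hT y (N := N) hN.ge (by omega)]
      omega
  refine ⟨Ray.mk' hT.connected p hadj hd, hp0, ?_⟩
  rw [Ray.endpoint_eq_iff hT.connected]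
  refine ⟨2 * M + 2 * N, fun n => ?_⟩
  change G.dist (p n) (r n) ≤ _
  rcases le_total n M with h | h
  · have h1 := hT.connected.dist_triangle (u := p n) (v := p 0) (w := r n)
    have h2 := hT.connected.dist_triangle (u := p 0) (v := r 0) (w := r n)
    rw [SimpleGraph.dist_comm (u := p n) (v := p 0), hd] at h1
    rw [r.dist_zero, hp0, SimpleGraph.dist_comm (u := y) (v := r 0)] at h2
    rw [hp0] at h1
    omega
  · rw [hp2 n h]
    rcases le_total (N + (n - M)) n with h' | h'
    · rw [r.dist_of_le h']; omega
    · rw [SimpleGraph.dist_comm, r.dist_of_le h']; omega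

/-- Membership in a shadow is decided by any vertex of the ray that is far enough. -/
theorem Ray.endpoint_mem_shadow_iff (hT : G.IsTree) (r : Ray G) (y w : V) {n : ℕ}
    (hn : 2 * G.dist (r 0) y + G.dist (r 0) w ≤ n) :
    r.endpoint ∈ shadow G y w ↔ r n ∈ cone G y w := by
  constructor
  · rintro ⟨s, rfl, hs, k, rfl⟩
    have h := Ray.merge hT hs.symm (n := n) (by omega)
    set m := G.dist (s 0) (r n)
    have h1 := hT.connected.dist_triangle (u := r 0) (v := s 0) (w := r n)
    have h2 := hT.connected.dist_triangle (u := s 0) (v := r 0) (w := s k)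
    rw [SimpleGraph.dist_comm (u := s 0) (v := r 0), s.dist_zero] at h2
    rw [r.dist_zero] at h1
    change n ≤ _ + m at h1
    change G.dist _ _ = _
    rw [h, s.dist_zero, s.dist_zero, s.dist_of_le (by omega)]
    omega
  · intro h
    obtain ⟨s, rfl, hs⟩ := exists_ray hT y r.endpoint
    refine ⟨s, rfl, hs, G.dist (s 0) w, ?_⟩
    have h1 := Ray.merge hT hs.symm (n := n) (by omega)
    have h : G.dist (s 0) (r n) = G.dist (s 0) w + G.dist w (r n) := h
    set m := G.dist (s 0) (r n)
    refine (eq_of_between hT (a := s 0) (b := r n) (s.dist_zero _).symm _ rfl h ?_).symm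
    rw [s.dist_zero, h1, s.dist_zero, s.dist_of_le (by omega)]
    omega

theorem Ray.tendsto_towards (hT : G.IsTree) (r : Ray G) :
    Tendsto r atTop (towards r.endpoint) := by
  simp only [towards, tendsto_iInf, tendsto_principal]
  intro x w h
  filter_upwards [eventually_ge_atTop (2 * G.dist (r 0) x + G.dist (r 0) w)] with n hn
  exact (r.endpoint_mem_shadow_iff hT x w hn).1 h

theorem towards_neBot (hT : G.IsTree) (ξ : Boundary G) : (towards ξ).NeBot := by
  obtain ⟨r, rfl⟩ := exists_ray_rep ξ
  exact (r.tendsto_towards hT).neBot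

theorem isOpen_shadow (x w : V) : IsOpen (shadow G x w) :=
  TopologicalSpace.isOpen_generateFrom_of_mem ⟨(x, w), rfl⟩

theorem tendsto_busemann_aux (hT : G.IsTree) {x y w : V} (hw : G.dist x y ≤ G.dist x w)
    {ξ : Boundary G} (h : ξ ∈ shadow G x w) :
    Tendsto (fun z => (G.dist y z : ℝ) - G.dist x z) (towards ξ)
      (𝓝 ((G.dist y w : ℝ) - G.dist x w)) := by
  have hmem : cone G x w ∈ towards ξ :=
    mem_iInf_of_mem x (mem_iInf_of_mem w (mem_iInf_of_mem h (mem_principal_self _)))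
  refine tendsto_nhds_of_eventually_eq ?_
  filter_upwards [hmem] with z (hz : G.dist x z = _)
  rw [dist_eq_of_le hT hw _ rfl hz, hz]
  push_cast
  ring

theorem busemannFun_eq (hT : G.IsTree) {x y w : V} (hw : G.dist x y ≤ G.dist x w)
    {ξ : Boundary G} (h : ξ ∈ shadow G x w) :
    busemannFun G x y ξ = (G.dist y w : ℝ) - G.dist x w :=
  haveI := towards_neBot hT ξ
  (tendsto_busemann_aux hT hw h).limUnder_eq

theorem exists_far_shadow (hT : G.IsTree) (x y : V) (ξ : Boundary G) :
    ∃ w, G.dist x y ≤ G.dist x w ∧ ξ ∈ shadow G x w := by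
  obtain ⟨r, rfl, hr⟩ := exists_ray hT x ξ
  exact ⟨r (G.dist (r 0) y), by rw [r.dist_zero], r, rfl, hr, _, rfl⟩

/-- The limit defining the Busemann cocycle exists. -/
theorem tendsto_busemannFun (hT : G.IsTree) (x y : V) (ξ : Boundary G) :
    Tendsto (fun z => (G.dist y z : ℝ) - G.dist x z) (towards ξ) (𝓝 (busemannFun G x y ξ)) := by
  obtain ⟨w, hw, h⟩ := exists_far_shadow hT x y ξ
  rw [busemannFun_eq hT hw h]
  exact tendsto_busemann_aux hT hw h

theorem continuous_busemannFun (hT : G.IsTree) (x y : V) : Continuous (busemannFun G x y) := by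
  refine continuous_iff_continuousAt.2 fun ξ => ?_
  obtain ⟨w, hw, h⟩ := exists_far_shadow hT x y ξ
  refine tendsto_nhds_of_eventually_eq ?_
  filter_upwards [(isOpen_shadow x w).mem_nhds h] with η hη
  rw [busemannFun_eq hT hw h, busemannFun_eq hT hw hη]

/-- The Busemann cocycle `B(x,y)` as an element of `C(∂X)`. -/
noncomputable def busemann (hT : G.IsTree) (x y : V) : C(Boundary G, ℂ) where
  toFun ξ := busemannFun G x y ξ
  continuous_toFun := Complex.continuous_ofReal.comp (continuous_busemannFun hT x y)

variable (G) in
/-- The subspace of constant functions in `C(∂X)`. -/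
noncomputable def constants : Submodule ℂ C(Boundary G, ℂ) := Submodule.span ℂ {1}

/-- The class of `B(x,y)` in `C(∂X)/ℂ`. -/
noncomputable def busemannClass (hT : G.IsTree) (x y : V) :
    C(Boundary G, ℂ) ⧸ constants G :=
  Submodule.Quotient.mk (busemann hT x y)

end RegularTree

namespace RegularTree

open SimpleGraph

/-- `G` is a `(q+1)`-regular tree, with `q ≥ 2`. -/
structure IsRegularTree {V : Type*} (G : SimpleGraph V) [G.LocallyFinite] (q : ℕ) : Prop where
  two_le : 2 ≤ q
  isTree : G.IsTree
  regular : G.IsRegularOfDegree (q + 1)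

variable {V : Type*} {G : SimpleGraph V}

theorem Ray.endpoint_mem_shadow_self_iff (hT : G.IsTree) (r : Ray G) (z : V) :
    r.endpoint ∈ shadow G (r 0) z ↔ r (G.dist (r 0) z) = z := by
  constructor
  · rintro ⟨s, hs0, hs, k, rfl⟩
    rw [← hs0, s.dist_zero]
    have h1 := Ray.merge hT hs.symm (n := k) (by rw [hs0]; simp)
    rwa [hs0, r.dist_zero] at h1
  · intro h
    exact ⟨r, rfl, rfl, _, h⟩

/-- The neighbors of `z` that are farther than `z` from `x`. -/
@[ext]
structure Child (G : SimpleGraph V) (x z : V) where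
  val : V
  adj : G.Adj z val
  dist_eq : G.dist x val = G.dist x z + 1

instance (x z : V) : TopologicalSpace (Child G x z) := ⊥
instance (x z : V) : DiscreteTopology (Child G x z) := ⟨rfl⟩
instance (x z : V) : MeasurableSpace (Child G x z) := ⊤
instance (x z : V) : DiscreteMeasurableSpace (Child G x z) := ⟨fun _ => trivial⟩

noncomputable instance [G.LocallyFinite] (x z : V) : Fintype (Child G x z) := by
  classical
  exact Fintype.ofInjective (fun w : Child G x z => (⟨w.val, w.adj⟩ : G.neighborSet z))
    (fun a b h => Child.ext (congrArg (fun c : G.neighborSet z => c.1) h))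

theorem card_child [G.LocallyFinite] {q : ℕ} (h : IsRegularTree G q) (x z : V) :
    (x = z → Fintype.card (Child G x z) = q + 1) ∧ (x ≠ z → Fintype.card (Child G x z) = q) := by
  classical
  have hdeg := h.regular z
  have key : Fintype.card (Child G x z) =
      ((G.neighborFinset z).filter fun w => G.dist x w = G.dist x z + 1).card := by
    rw [← Finset.card_univ]
    refine Finset.card_bij (fun c _ => c.val) ?_ ?_ ?_
    · intro c _
      simpa using ⟨c.adj, c.dist_eq⟩
    · intro c _ c' _ hcc
      exact Child.ext hcc
    · intro w hw
      simp only [Finset.mem_filter, mem_neighborFinset] at hw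
      exact ⟨⟨w, hw.1, hw.2⟩, Finset.mem_univ _, rfl⟩
  constructor
  · rintro rfl
    rw [key, Finset.filter_true_of_mem, card_neighborFinset_eq_degree, hdeg]
    intro w hw
    rw [mem_neighborFinset] at hw
    rw [dist_eq_one_iff_adj.2 hw, SimpleGraph.dist_self]
  · intro hne
    obtain ⟨b, hb, hbd⟩ := exists_adj_dist h.isTree hne
    have : ((G.neighborFinset z).filter fun w => G.dist x w = G.dist x z + 1) =
        (G.neighborFinset z).erase b := by
      ext w
      simp only [Finset.mem_filter, mem_neighborFinset, Finset.mem_erase]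
      constructor
      · rintro ⟨h1, h2⟩
        exact ⟨by rintro rfl; omega, h1⟩
      · rintro ⟨h1, h2⟩
        refine ⟨h2, ?_⟩
        rcases h.isTree.dist_eq_dist_add_one_of_adj x h2 with h3 | h3
        · exact absurd (eq_of_adj_of_dist h.isTree h2.symm hb h3 hbd) h1
        · exact h3
    rw [key, this, Finset.card_erase_of_mem (by simpa using hb.symm),
      card_neighborFinset_eq_degree, hdeg]
    omega

theorem nonempty_child [G.LocallyFinite] {q : ℕ} (h : IsRegularTree G q) (x z : V) :
    Nonempty (Child G x z) := by
  have h2 := h.two_le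
  rw [← Fintype.card_pos_iff]
  by_cases hz : x = z
  · rw [(card_child h x z).1 hz]; omega
  · rw [(card_child h x z).2 hz]; omega

theorem countable_vertices [G.LocallyFinite] (hT : G.IsTree) : Countable V := by
  obtain ⟨x⟩ := hT.connected.nonempty
  have hfin : ∀ n, {v | G.dist x v = n}.Finite := by
    intro n
    induction n with
    | zero =>
      refine (Set.finite_singleton x).subset fun v hv => ?_
      exact (hT.connected.dist_eq_zero_iff.1 hv).symm
    | succ n ih =>
      refine (ih.biUnion fun z _ => (G.neighborSet z).toFinite).subset fun v hv => ?_
      have hv : G.dist x v = n + 1 := hv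
      obtain ⟨b, hb, hbd⟩ := exists_adj_dist hT (v := x) (c := v) (by rintro rfl; simp at hv)
      simp only [Set.mem_iUnion]
      exact ⟨b, by change G.dist x b = n; omega, hb⟩
  rw [← Set.countable_univ_iff]
  refine (Set.countable_iUnion fun n => (hfin n).countable).mono fun v _ => ?_
  exact Set.mem_iUnion.2 ⟨G.dist x v, rfl⟩

/-- Starting at `x`, follow the selected children. -/
def follow {x : V} (ω : ∀ z, Child G x z) : ℕ → V
  | 0 => x
  | n + 1 => (ω (follow ω n)).val

theorem follow_dist {x : V} (ω : ∀ z, Child G x z) (n : ℕ) : G.dist x (follow ω n) = n := by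
  induction n with
  | zero => simp [follow]
  | succ n ih => rw [follow, (ω (follow ω n)).dist_eq, ih]

/-- The ray that follows the selected children. -/
def followRay (hG : G.Connected) {x : V} (ω : ∀ z, Child G x z) : Ray G :=
  Ray.mk' hG (follow ω) (fun n => (ω (follow ω n)).adj) (follow_dist ω)

theorem follow_eventually_eq {x : V} (ω₀ : ∀ z, Child G x z) (n : ℕ) :
    ∀ᶠ ω in 𝓝 ω₀, follow ω n = follow ω₀ n := by
  induction n with
  | zero => exact Eventually.of_forall fun _ => rfl
  | succ n ih =>
    have h : ∀ᶠ ω in 𝓝 ω₀, ω (follow ω₀ n) = ω₀ (follow ω₀ n) :=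
      ((isOpen_discrete {ω₀ (follow ω₀ n)}).preimage
        (continuous_apply (A := fun z => Child G x z) (follow ω₀ n))).mem_nhds rfl
    filter_upwards [ih, h] with ω h1 h2
    rw [follow, h1, h2, follow]

theorem continuous_followRay (hT : G.IsTree) (x : V) :
    Continuous fun ω : (∀ z, Child G x z) => (followRay hT.connected ω).endpoint := by
  refine continuous_generateFrom_iff.2 ?_
  rintro _ ⟨⟨y, w⟩, rfl⟩
  rw [isOpen_iff_mem_nhds]
  intro ω₀ h₀
  have key : ∀ ω : (∀ z, Child G x z), (followRay hT.connected ω).endpoint ∈ shadow G y w ↔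
      follow ω (2 * G.dist x y + G.dist x w) ∈ cone G y w :=
    fun ω => Ray.endpoint_mem_shadow_iff hT (followRay hT.connected ω) y w le_rfl
  filter_upwards [follow_eventually_eq ω₀ (2 * G.dist x y + G.dist x w)] with ω h
  have h₀ := (key ω₀).1 h₀
  rw [← h] at h₀
  exact (key ω).2 h₀

theorem surjective_followRay [G.LocallyFinite] {q : ℕ} (h : IsRegularTree G q) (x : V) :
    Function.Surjective
      fun ω : (∀ z, Child G x z) => (followRay h.isTree.connected ω).endpoint := by
  classical
  intro ξ
  obtain ⟨r, rfl, rfl⟩ := exists_ray h.isTree x ξ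
  have hne := fun z => (nonempty_child h (r 0) z).some
  let ω : ∀ z, Child G (r 0) z := fun z =>
    if hz : r (G.dist (r 0) z) = z then
      ⟨r (G.dist (r 0) z + 1), by
        have := r.adj (G.dist (r 0) z)
        rwa [hz] at this, by rw [r.dist_zero]⟩
    else hne z
  have key : ∀ n, follow ω n = r n := by
    intro n
    induction n with
    | zero => rfl
    | succ n ih =>
      rw [follow, ih]
      have hz : r (G.dist (r 0) (r n)) = r n := by rw [r.dist_zero]
      have h1 : ω (r n) = ⟨r (G.dist (r 0) (r n) + 1), _, _⟩ := dif_pos hz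
      rw [h1]
      change r (G.dist (r 0) (r n) + 1) = _
      rw [r.dist_zero]
  refine ⟨ω, ?_⟩
  rw [Ray.endpoint_eq_iff h.isTree.connected]
  refine ⟨0, fun n => ?_⟩
  change G.dist (follow ω n) (r n) ≤ 0
  rw [key]; simp

theorem compactSpace_boundary [G.LocallyFinite] {q : ℕ} (h : IsRegularTree G q) :
    CompactSpace (Boundary G) := by
  obtain ⟨x⟩ := h.isTree.connected.nonempty
  refine ⟨?_⟩
  rw [← (surjective_followRay h x).range_eq]
  exact isCompact_range (continuous_followRay h.isTree x)

theorem follow_cylinder [G.LocallyFinite] {q : ℕ} (h : IsRegularTree G q) (x : V) :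
    ∀ (n : ℕ) (z : V), G.dist x z = n + 1 → ∃ (s : Finset V) (t : ∀ v, Set (Child G x v)),
      (∀ v ∈ s, G.dist x v ≤ n) ∧
      {ω : ∀ v, Child G x v | follow ω (n + 1) = z} = Set.pi s t ∧
      ∀ m : V → ℝ≥0∞, (∀ v ∈ s, m v = ((Fintype.card (Child G x v) : ℕ) : ℝ≥0∞)⁻¹) →
        (∀ v ∈ s, ∃ c, t v = {c}) ∧
        ∏ v ∈ s, m v = (((q : ℝ≥0∞) + 1) * (q : ℝ≥0∞) ^ n)⁻¹ := by
  classical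
  intro n
  induction n with
  | zero =>
    intro z hz
    have hadj : G.Adj x z := dist_eq_one_iff_adj.1 hz
    have hc : G.Adj x z ∧ G.dist x z = G.dist x x + 1 := ⟨hadj, by simpa using hz⟩
    refine ⟨{x}, fun v => {c | c.val = z}, by simp, ?_, ?_⟩
    · ext ω
      simp [follow]
    · intro m hm
      refine ⟨?_, ?_⟩
      · simp only [Finset.mem_singleton, forall_eq]
        exact ⟨⟨z, hc.1, hc.2⟩, by
          ext c
          exact ⟨fun h' => Child.ext h', fun h' => congrArg Child.val h'⟩⟩
      · rw [Finset.prod_singleton, hm x (by simp), (card_child h x x).1 rfl]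
        simp
  | succ n ih =>
    intro z hz
    have hne : x ≠ z := by rintro rfl; simp at hz
    obtain ⟨b, hb, hbd⟩ := exists_adj_dist h.isTree hne
    obtain ⟨s, t, hs, hst, hm'⟩ := ih b (by omega)
    have hbs : b ∉ s := fun hmem => by have := hs b hmem; omega
    have hc : G.Adj b z ∧ G.dist x z = G.dist x b + 1 := ⟨hb, hbd⟩
    refine ⟨insert b s, Function.update t b {⟨z, hc.1, hc.2⟩}, ?_, ?_, ?_⟩
    · intro v hv
      rcases Finset.mem_insert.1 hv with rfl | hv
      · omega
      · have := hs v hv; omega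
    · ext ω
      have h1 : follow ω (n + 1) = b ↔ ω ∈ Set.pi s t := by rw [← hst]; rfl
      have h2 : ω ∈ Set.pi (↑(insert b s) : Set V) (Function.update t b {⟨z, hc.1, hc.2⟩}) ↔
          ω b = ⟨z, hc.1, hc.2⟩ ∧ ω ∈ Set.pi s t := by
        rw [Finset.coe_insert, Set.insert_pi, Set.mem_inter_iff]
        refine and_congr (by rw [Set.mem_preimage, Function.update_self]; rfl) ?_
        simp only [Set.mem_pi]
        refine forall₂_congr fun v hv => ?_
        rw [Function.update_of_ne (by rintro rfl; exact hbs hv)]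
      rw [h2, ← h1]
      change (ω (follow ω (n + 1))).val = z ↔ _
      constructor
      · intro h3
        have h4 : G.Adj (follow ω (n + 1)) z ∧ G.dist x z = G.dist x (follow ω (n + 1)) + 1 := by
          conv => rw [← h3]
          exact ⟨(ω (follow ω (n + 1))).adj, (ω (follow ω (n + 1))).dist_eq⟩
        have h5 := eq_of_adj_of_dist h.isTree hb h4.1 hbd h4.2
        refine ⟨Child.ext ?_, h5.symm⟩
        change (ω b).val = z
        rw [h5]; exact h3
      · rintro ⟨h3, h4⟩
        rw [h4, h3]
    · intro m hm
      obtain ⟨h1, h2⟩ := hm' m fun v hv => hm v (Finset.mem_insert_of_mem hv)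
      refine ⟨?_, ?_⟩
      · intro v hv
        by_cases hvb : v = b
        · subst hvb
          exact ⟨⟨z, hc.1, hc.2⟩, by simp⟩
        · rw [Function.update_of_ne hvb]
          exact h1 v (Finset.mem_of_mem_insert_of_ne hv hvb)
      · rw [Finset.prod_insert hbs, h2, hm b (Finset.mem_insert_self _ _),
          (card_child h x b).2 (by rintro rfl; rw [SimpleGraph.dist_self] at hbd; omega),
          ← ENNReal.mul_inv (Or.inr (by finiteness)) (Or.inl (by finiteness))]
        congr 1
        ring

theorem exists_visualMeasure [G.LocallyFinite] {q : ℕ} (h : IsRegularTree G q) (x : V) :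
    ∃ ν : Measure (Boundary G), IsProbabilityMeasure ν ∧
      ∀ (n : ℕ) (z : V), G.dist x z = n + 1 →
        ν (shadow G x z) = (((q : ℝ≥0∞) + 1) * (q : ℝ≥0∞) ^ n)⁻¹ := by
  have : Countable V := countable_vertices h.isTree
  have := fun z => nonempty_child h x z
  let P : Measure (∀ z, Child G x z) :=
    Measure.infinitePi fun z => (PMF.uniformOfFintype (Child G x z)).toMeasure
  have hmeas : Measurable fun ω : (∀ z, Child G x z) =>
      (followRay h.isTree.connected ω).endpoint :=
    (continuous_followRay h.isTree x).measurable
  refine ⟨P.map _, Measure.isProbabilityMeasure_map hmeas.aemeasurable, fun n z hz => ?_⟩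
  rw [Measure.map_apply hmeas (isOpen_shadow x z).measurableSet]
  have hpre : (fun ω : (∀ z, Child G x z) => (followRay h.isTree.connected ω).endpoint) ⁻¹'
      shadow G x z = {ω | follow ω (n + 1) = z} := by
    ext ω
    have := (followRay h.isTree.connected ω).endpoint_mem_shadow_self_iff h.isTree z
    change _ ↔ follow ω (G.dist x z) = z at this
    rw [hz] at this
    exact this
  obtain ⟨s, t, -, hst, hm⟩ := follow_cylinder h x n z hz
  rw [hpre, hst]
  obtain ⟨h1, h2⟩ := hm (fun v => ((Fintype.card (Child G x v) : ℕ) : ℝ≥0∞)⁻¹) fun _ _ => rfl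
  rw [Measure.infinitePi_pi _ (fun v _ => MeasurableSet.of_discrete), ← h2]
  refine Finset.prod_congr rfl fun v hv => ?_
  obtain ⟨c, hc⟩ := h1 v hv
  rw [hc, PMF.toMeasure_apply_singleton _ _ (MeasurableSet.singleton c),
    PMF.uniformOfFintype_apply]

/-- The visual measure `ν_x`: the Borel probability measure on the boundary such that
`ν_x(Ω_x(z)) = 1 / ((q+1) q^(n-1))` for every vertex `z` at distance `n ≥ 1` from `x`. -/
noncomputable def visualMeasure [G.LocallyFinite] {q : ℕ} (h : IsRegularTree G q) (x : V) :
    Measure (Boundary G) :=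
  (exists_visualMeasure h x).choose

instance [G.LocallyFinite] {q : ℕ} (h : IsRegularTree G q) (x : V) :
    IsProbabilityMeasure (visualMeasure h x) :=
  (exists_visualMeasure h x).choose_spec.1

theorem visualMeasure_shadow [G.LocallyFinite] {q : ℕ} (h : IsRegularTree G q) (x : V) (n : ℕ)
    (z : V) (hz : G.dist x z = n + 1) :
    visualMeasure h x (shadow G x z) = (((q : ℝ≥0∞) + 1) * (q : ℝ≥0∞) ^ n)⁻¹ :=
  (exists_visualMeasure h x).choose_spec.2 n z hz

/-- The measure `ν_e⁺ = (q+1)/q • ν_{o(e)}|_{Ω_e⁺}`, where `Ω_e⁺ = Ω_{t(e)}(o(e))`. -/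
noncomputable def edgePlus [G.LocallyFinite] {q : ℕ} (h : IsRegularTree G q) (e : G.Dart) :
    Measure (Boundary G) :=
  (((q : ℝ≥0∞) + 1) / q) • (visualMeasure h e.fst).restrict (shadow G e.snd e.fst)

/-- The measure `ν_e⁻ = (q+1) • ν_{o(e)}|_{Ω_e⁻}`, where `Ω_e⁻ = Ω_{o(e)}(t(e))`. -/
noncomputable def edgeMinus [G.LocallyFinite] {q : ℕ} (h : IsRegularTree G q) (e : G.Dart) :
    Measure (Boundary G) :=
  ((q : ℝ≥0∞) + 1) • (visualMeasure h e.fst).restrict (shadow G e.fst e.snd)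

theorem compl_shadow (hT : G.IsTree) (e : G.Dart) :
    (shadow G e.fst e.snd)ᶜ = shadow G e.snd e.fst := by
  ext ξ
  obtain ⟨r, rfl⟩ := exists_ray_rep ξ
  set N := 2 * G.dist (r 0) e.fst + 2 * G.dist (r 0) e.snd
  have h1 := r.endpoint_mem_shadow_iff hT e.fst e.snd
    (n := N) (by omega)
  have h2 := r.endpoint_mem_shadow_iff hT e.snd e.fst
    (n := N) (by omega)
  rw [Set.mem_compl_iff, h1, h2]
  change ¬ (G.dist _ _ = _) ↔ G.dist _ _ = _
  rw [dist_eq_one_iff_adj.2 e.adj, dist_eq_one_iff_adj.2 e.adj.symm]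
  rcases hT.dist_eq_dist_add_one_of_adj
    (r N) e.adj with h | h <;>
  · rw [SimpleGraph.dist_comm (u := r N), SimpleGraph.dist_comm (u := r N)] at h
    omega

theorem visualMeasure_target [G.LocallyFinite] {q : ℕ} (h : IsRegularTree G q) (e : G.Dart) :
    visualMeasure h e.fst (shadow G e.fst e.snd) = ((q : ℝ≥0∞) + 1)⁻¹ := by
  rw [visualMeasure_shadow h _ 0 _ (dist_eq_one_iff_adj.2 e.adj)]
  simp

instance [G.LocallyFinite] {q : ℕ} (h : IsRegularTree G q) (e : G.Dart) :
    IsProbabilityMeasure (edgeMinus h e) := by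
  refine ⟨?_⟩
  rw [edgeMinus, Measure.smul_apply, Measure.restrict_apply_univ, visualMeasure_target,
    smul_eq_mul]
  exact ENNReal.mul_inv_cancel (by simp) (by finiteness)

instance [G.LocallyFinite] {q : ℕ} (h : IsRegularTree G q) (e : G.Dart) :
    IsProbabilityMeasure (edgePlus h e) := by
  refine ⟨?_⟩
  have hq : (q : ℝ≥0∞) ≠ 0 := by have := h.two_le; simp; omega
  have h1 : ((q : ℝ≥0∞) + 1) * ((q : ℝ≥0∞) + 1)⁻¹ = 1 :=
    ENNReal.mul_inv_cancel (by simp) (by finiteness)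
  have h2 : 1 - ((q : ℝ≥0∞) + 1)⁻¹ = q * ((q : ℝ≥0∞) + 1)⁻¹ := by
    refine ENNReal.sub_eq_of_eq_add (by simp) ?_
    exact (add_one_mul _ _).symm.trans h1 |>.symm
  rw [edgePlus, Measure.smul_apply, Measure.restrict_apply_univ, ← compl_shadow h.isTree,
    prob_compl_eq_one_sub (isOpen_shadow _ _).measurableSet, visualMeasure_target,
    smul_eq_mul, h2, div_eq_mul_inv, mul_assoc, ← mul_assoc (q : ℝ≥0∞)⁻¹,
    ENNReal.inv_mul_cancel hq (by finiteness), one_mul, h1]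

theorem integrable_continuousMap [G.LocallyFinite] {q : ℕ} (h : IsRegularTree G q)
    (μ : Measure (Boundary G)) [IsFiniteMeasure μ] (φ : C(Boundary G, ℂ)) : Integrable φ μ :=
  haveI := compactSpace_boundary h
  Integrable.of_bound φ.continuous.aestronglyMeasurable ‖φ‖
    (Eventually.of_forall fun ξ => φ.norm_coe_le_norm ξ)

/-- The Poisson transform `φ ↦ (e ↦ ∫ φ dν_e)` on `C(∂X)`, where `ν_e = ν_e⁺ - ν_e⁻` and `e` ranges
over the oriented edges. -/
noncomputable def poissonFun [G.LocallyFinite] {q : ℕ} (h : IsRegularTree G q) :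
    C(Boundary G, ℂ) →ₗ[ℂ] (G.Dart → ℂ) where
  toFun φ e := ∫ ξ, φ ξ ∂edgePlus h e - ∫ ξ, φ ξ ∂edgeMinus h e
  map_add' φ ψ := by
    ext e
    simp only [ContinuousMap.add_apply, Pi.add_apply]
    rw [integral_add (integrable_continuousMap h _ φ) (integrable_continuousMap h _ ψ),
      integral_add (integrable_continuousMap h _ φ) (integrable_continuousMap h _ ψ)]
    ring
  map_smul' c φ := by
    ext e
    simp only [ContinuousMap.smul_apply, Pi.smul_apply, RingHom.id_apply]
    rw [integral_smul, integral_smul, smul_sub]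

theorem constants_le_ker [G.LocallyFinite] {q : ℕ} (h : IsRegularTree G q) :
    constants G ≤ LinearMap.ker (poissonFun h) := by
  rw [constants, Submodule.span_le, Set.singleton_subset_iff, SetLike.mem_coe, LinearMap.mem_ker]
  ext e
  simp [poissonFun]

/-- The Poisson transform on `C(∂X)/ℂ`. -/
noncomputable def poisson [G.LocallyFinite] {q : ℕ} (h : IsRegularTree G q) :
    (C(Boundary G, ℂ) ⧸ constants G) →ₗ[ℂ] (G.Dart → ℂ) :=
  (constants G).liftQ (poissonFun h) (constants_le_ker h)

end RegularTree

/-!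
The Poisson transform of the Busemann cocycle is explicit. Fix an oriented edge `e` and let
`F_e(z) = ±((q + 1) - 2 q ^ (-d(z, e))) / (q - 1)`, with the sign `+` if the vertex `z` is on the
side of the target of `e` and `-` otherwise. Then `𝒫 B(x,y)(e) = F_e(y) - F_e(x)`
(`poissonFun_busemann`). Both sides are additive along paths, so it is enough to take `x` and `y`
adjacent, and by antisymmetry `y` farther than `x` from the origin `o` of `e`. In that case
`B(x,y) = 1 - 2 · 1_S` with `S = Ω_x(y) = Ω_o(y)`, and `S` lies on one side of `e`, so `ν_e(S)` is
read off from `ν_o(S)`.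

If `e` separates `x` from `y`, the two values of `F_e` have opposite signs and
`2 ≤ |𝒫 B(x,y)(e)| ≤ 2 (q + 1) / (q - 1)`. The oriented edges with this property are those of the
geodesic from `x` to `y`, in both directions. There are at least `d(x,y)` and at most `2 d(x,y)` of
them, which gives the lower bound and the linear term of the upper bound.

If `e` does not separate, then
`|𝒫 B(x,y)(e)|² ≤ 4 (q ^ (-2 d(x,e)) + q ^ (-2 d(y,e))) / (q - 1)²`. Since the sphere of radius
`k + 1` has at most `(q + 1) q ^ k` points (`card_sphere_le`), the sum of `q ^ (-2 d(x,e))` over all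
oriented edges is at most `2 (q + 1) q / (q - 1)` (`sum_darts_le`). So the remaining edges contribute
at most `16 q (q + 1) / (q - 1)³`, which is at most `K` because `q² ≥ q + 1`.
-/

namespace RegularTree

open SimpleGraph

variable {V : Type*} {G : SimpleGraph V}

/-! ### Shadows of neighboring vertices -/

theorem shadow_eq_of_adj (hT : G.IsTree) {a c d : V} (hcd : G.Adj c d)
    (hd : G.dist a d = G.dist a c + 1) : shadow G c d = shadow G a d := by
  ext ξ
  obtain ⟨r, rfl⟩ := exists_ray_rep ξ
  set N := 2 * G.dist (r 0) c + 2 * G.dist (r 0) a + G.dist (r 0) d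
  rw [r.endpoint_mem_shadow_iff hT c d (n := N) (by omega),
    r.endpoint_mem_shadow_iff hT a d (n := N) (by omega)]
  generalize r N = z
  change G.dist c z = G.dist c d + G.dist d z ↔ G.dist a z = G.dist a d + G.dist d z
  have hcd1 := dist_eq_one_iff_adj.2 hcd
  have c1 : G.dist z d = G.dist d z := SimpleGraph.dist_comm
  have c2 : G.dist z c = G.dist c z := SimpleGraph.dist_comm
  constructor
  · intro h
    have := dist_across hT (x := a) (y := z) (G.dist z d) hcd rfl hd (by omega)
    omega
  · intro h
    have h1 := hT.connected.dist_triangle (u := a) (v := c) (w := z)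
    have h2 := hT.connected.dist_triangle (u := c) (v := d) (w := z)
    omega

theorem shadow_subset_of_dist (hT : G.IsTree) {a b d : V} (hab : G.Adj a b)
    (hd : G.dist a d = G.dist b d + 1) : shadow G a d ⊆ shadow G a b := by
  intro ξ
  obtain ⟨r, rfl⟩ := exists_ray_rep ξ
  set N := 2 * G.dist (r 0) a + G.dist (r 0) b + G.dist (r 0) d
  rw [r.endpoint_mem_shadow_iff hT a d (n := N) (by omega),
    r.endpoint_mem_shadow_iff hT a b (n := N) (by omega)]
  generalize r N = z
  change G.dist a z = G.dist a d + G.dist d z → G.dist a z = G.dist a b + G.dist b z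
  have hab1 := dist_eq_one_iff_adj.2 hab
  have h1 := hT.connected.dist_triangle (u := a) (v := b) (w := z)
  have h2 := hT.connected.dist_triangle (u := b) (v := d) (w := z)
  omega

theorem shadow_subset_of_dist' (hT : G.IsTree) {a b d : V} (hab : G.Adj a b) (had : a ≠ d)
    (hd : G.dist b d = G.dist a d + 1) : shadow G a d ⊆ shadow G b a := by
  intro ξ
  obtain ⟨r, rfl⟩ := exists_ray_rep ξ
  set N := 2 * G.dist (r 0) a + 2 * G.dist (r 0) b + G.dist (r 0) d
  rw [r.endpoint_mem_shadow_iff hT a d (n := N) (by omega),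
    r.endpoint_mem_shadow_iff hT b a (n := N) (by omega)]
  generalize r N = z
  change G.dist a z = G.dist a d + G.dist d z → G.dist b z = G.dist b a + G.dist a z
  intro h
  have hba1 := dist_eq_one_iff_adj.2 hab.symm
  have hpos := hT.connected.pos_dist_of_ne had
  have c1 : G.dist z a = G.dist a z := SimpleGraph.dist_comm
  have c2 : G.dist z b = G.dist b z := SimpleGraph.dist_comm
  have c3 : G.dist d a = G.dist a d := SimpleGraph.dist_comm
  have c4 : G.dist d b = G.dist b d := SimpleGraph.dist_comm
  rcases hT.dist_eq_dist_add_one_of_adj z hab with h1 | h1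
  · have := dist_across hT (x := d) (y := z) (G.dist z b) hab rfl (by omega) (by omega)
    omega
  · omega

/-! ### The Busemann cocycle -/

theorem busemannFun_add (hT : G.IsTree) (x y z : V) (ξ : Boundary G) :
    busemannFun G x z ξ = busemannFun G x y ξ + busemannFun G y z ξ := by
  have := towards_neBot hT ξ
  refine tendsto_nhds_unique (tendsto_busemannFun hT x z ξ)
    (((tendsto_busemannFun hT x y ξ).add (tendsto_busemannFun hT y z ξ)).congr fun w => ?_)
  ring

theorem busemannFun_self (hT : G.IsTree) (x : V) (ξ : Boundary G) :
    busemannFun G x x ξ = 0 := by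
  have := busemannFun_add hT x x x ξ
  linarith

theorem busemann_add (hT : G.IsTree) (x y z : V) :
    busemann hT x z = busemann hT x y + busemann hT y z := by
  ext ξ
  change ((busemannFun G x z ξ : ℝ) : ℂ) = (busemannFun G x y ξ : ℝ) + (busemannFun G y z ξ : ℝ)
  rw [busemannFun_add hT x y z, Complex.ofReal_add]

theorem busemann_self (hT : G.IsTree) (x : V) : busemann hT x x = 0 := by
  ext ξ
  change ((busemannFun G x x ξ : ℝ) : ℂ) = 0
  rw [busemannFun_self hT, Complex.ofReal_zero]

theorem busemannFun_of_adj (hT : G.IsTree) {c d : V} (hcd : G.Adj c d) (ξ : Boundary G) :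
    busemannFun G c d ξ = 1 - 2 * (shadow G c d).indicator (fun _ => (1 : ℝ)) ξ := by
  by_cases h : ξ ∈ shadow G c d
  · rw [busemannFun_eq hT le_rfl h, Set.indicator_of_mem h, dist_eq_one_iff_adj.2 hcd]
    norm_num
  · have h' : ξ ∈ shadow G d c := by
      rw [← compl_shadow hT ⟨(c, d), hcd⟩]
      exact h
    have h1 := busemannFun_add hT c d c ξ
    rw [busemannFun_self hT, busemannFun_eq hT le_rfl h', dist_eq_one_iff_adj.2 hcd.symm,
      SimpleGraph.dist_self] at h1
    rw [Set.indicator_of_notMem h]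
    push_cast at h1
    linarith

theorem integral_busemann_of_adj (hT : G.IsTree) {c d : V} (hcd : G.Adj c d)
    (μ : Measure (Boundary G)) [IsProbabilityMeasure μ] :
    ∫ ξ, busemann hT c d ξ ∂μ = ((1 - 2 * μ.real (shadow G c d) : ℝ) : ℂ) := by
  have hS : MeasurableSet (shadow G c d) := (isOpen_shadow c d).measurableSet
  change ∫ ξ, ((busemannFun G c d ξ : ℝ) : ℂ) ∂μ = _
  rw [integral_complex_ofReal]
  simp_rw [busemannFun_of_adj hT hcd]
  rw [integral_sub (integrable_const _)
      (((integrable_const (1 : ℝ)).indicator hS).const_mul 2), integral_const,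
    integral_const_mul, integral_indicator hS, setIntegral_const]
  simp

/-! ### The Poisson transform of the Busemann cocycle -/

/-- The distance from the vertex `z` to the geometric edge underlying the dart `e`. -/
noncomputable def edgeDist (e : G.Dart) (z : V) : ℕ := min (G.dist e.fst z) (G.dist e.snd z)

/-- The side of the oriented edge `e` on which the vertex `z` lies: `1` if `z` is nearer to the
target, `-1` if it is nearer to the origin. In a tree there are no ties. -/
noncomputable def edgeSide (e : G.Dart) (z : V) : ℝ :=
  if G.dist e.snd z < G.dist e.fst z then 1 else -1

/-- A potential for the Poisson transform of the Busemann cocycle at `e`: the values of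
`𝒫 B(x,y)` at `e` are the differences of its values at `y` and `x`. The additive constant is chosen
so that the potential is odd under reversal of `e`. -/
noncomputable def edgePotential (q : ℕ) (e : G.Dart) (z : V) : ℝ :=
  edgeSide e z * ((q + 1 - 2 * (q : ℝ)⁻¹ ^ edgeDist e z) / (q - 1))

section

variable [G.LocallyFinite] {q : ℕ}

theorem visualMeasure_real_shadow (h : IsRegularTree G q) {x z : V} {n : ℕ}
    (hz : G.dist x z = n + 1) :
    (visualMeasure h x).real (shadow G x z) = (((q : ℝ) + 1) * (q : ℝ) ^ n)⁻¹ := by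
  rw [Measure.real, visualMeasure_shadow h x n z hz]
  simp [ENNReal.toReal_add]

theorem edgeMinus_real (h : IsRegularTree G q) (e : G.Dart) {S : Set (Boundary G)}
    (hS : MeasurableSet S) : (edgeMinus h e).real S =
      (q + 1) * (visualMeasure h e.fst).real (S ∩ shadow G e.fst e.snd) := by
  rw [edgeMinus, Measure.real, Measure.smul_apply, Measure.restrict_apply hS, smul_eq_mul,
    ENNReal.toReal_mul, Measure.real]
  simp [ENNReal.toReal_add]

theorem edgePlus_real (h : IsRegularTree G q) (e : G.Dart) {S : Set (Boundary G)}
    (hS : MeasurableSet S) : (edgePlus h e).real S =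
      (q + 1) / q * (visualMeasure h e.fst).real (S ∩ shadow G e.snd e.fst) := by
  rw [edgePlus, Measure.real, Measure.smul_apply, Measure.restrict_apply hS, smul_eq_mul,
    ENNReal.toReal_mul, Measure.real]
  simp [ENNReal.toReal_add]

theorem poissonFun_busemann_of_adj (h : IsRegularTree G q) {c d : V} (hcd : G.Adj c d)
    (e : G.Dart) : poissonFun h (busemann h.isTree c d) e =
      ((2 * ((edgeMinus h e).real (shadow G c d) - (edgePlus h e).real (shadow G c d)) : ℝ) :
        ℂ) := by
  change ∫ ξ, busemann h.isTree c d ξ ∂edgePlus h e -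
    ∫ ξ, busemann h.isTree c d ξ ∂edgeMinus h e = _
  rw [integral_busemann_of_adj _ hcd, integral_busemann_of_adj _ hcd]
  push_cast
  ring

/-- The case of a step `c → d` that leads away from the origin of `e`. Then the shadow of `d` seen
from `c` is the shadow seen from the origin of `e`, whose visual measure is known, and it lies
entirely on one side of `e`. -/
theorem poissonFun_busemann_of_adj_of_dist (h : IsRegularTree G q) {c d : V} (hcd : G.Adj c d)
    (e : G.Dart) (hd : G.dist e.fst d = G.dist e.fst c + 1) :
    poissonFun h (busemann h.isTree c d) e =
      ((edgePotential q e d - edgePotential q e c : ℝ) : ℂ) := by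
  have hT := h.isTree
  have hq : (2 : ℝ) ≤ q := by exact_mod_cast h.two_le
  have hq1 : (q : ℝ) - 1 ≠ 0 := by linarith
  have hq0 : (q : ℝ) ≠ 0 := by linarith
  have hq2 : (q : ℝ) + 1 ≠ 0 := by linarith
  have hS : MeasurableSet (shadow G e.fst d) := (isOpen_shadow _ d).measurableSet
  have hne : e.fst ≠ d := by intro h0; rw [h0, SimpleGraph.dist_self] at hd; omega
  have hcompl := compl_shadow hT e
  rw [poissonFun_busemann_of_adj h hcd, shadow_eq_of_adj hT hcd hd, edgeMinus_real h e hS,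
    edgePlus_real h e hS]
  congr 1
  have hν := visualMeasure_real_shadow h hd
  have hd' := hT.dist_eq_dist_add_one_of_adj d e.adj
  have hc' := hT.dist_eq_dist_add_one_of_adj c e.adj
  have htri := hT.connected.dist_triangle (u := e.snd) (v := d) (w := c)
  have htri' := hT.connected.dist_triangle (u := e.snd) (v := c) (w := d)
  rw [dist_eq_one_iff_adj.2 hcd] at htri'
  rw [dist_eq_one_iff_adj.2 hcd.symm] at htri
  rw [SimpleGraph.dist_comm (u := d), SimpleGraph.dist_comm (u := d)] at hd'
  rw [SimpleGraph.dist_comm (u := c), SimpleGraph.dist_comm (u := c)] at hc'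
  rcases hd' with hd' | hd'
  · have hsub := shadow_subset_of_dist hT e.adj hd'
    have hdisj : shadow G e.fst d ∩ shadow G e.snd e.fst = ∅ := by
      rw [← hcompl]
      exact Set.disjoint_iff_inter_eq_empty.1 (Set.disjoint_compl_right_iff_subset.2 hsub)
    rw [Set.inter_eq_left.2 hsub, hdisj, hν, measureReal_empty]
    have sd : edgeSide e d = 1 := if_pos (by omega)
    have ld : edgeDist e d = G.dist e.fst c := by unfold edgeDist; omega
    rcases hc' with hc' | hc'
    · have sc : edgeSide e c = 1 := if_pos (by omega)
      obtain ⟨k, hk⟩ : ∃ k, G.dist e.fst c = k + 1 := ⟨_, hc'⟩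
      have lc : edgeDist e c = k := by unfold edgeDist; omega
      rw [edgePotential, edgePotential, sd, ld, sc, lc, hk, inv_pow, inv_pow]
      field_simp
      ring
    · have sc : edgeSide e c = -1 := if_neg (by omega)
      have hk : G.dist e.fst c = 0 := by
        -- The step crosses `e`, so the geodesic from `c` to `d` passes through both ends of `e`.
        have c1 : G.dist e.fst c = G.dist c e.fst := SimpleGraph.dist_comm
        have c2 : G.dist e.snd c = G.dist c e.snd := SimpleGraph.dist_comm
        have c3 : G.dist e.fst d = G.dist d e.fst := SimpleGraph.dist_comm
        have c4 : G.dist e.snd d = G.dist d e.snd := SimpleGraph.dist_comm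
        have := dist_across hT (x := c) (y := d) _ e.adj rfl (by omega) (by omega)
        rw [dist_eq_one_iff_adj.2 hcd] at this
        omega
      have lc : edgeDist e c = 0 := by unfold edgeDist; omega
      rw [edgePotential, edgePotential, sd, ld, sc, lc, hk, pow_zero, pow_zero]
      field_simp
      ring
  · have hsub := shadow_subset_of_dist' hT e.adj hne hd'
    have hdisj : shadow G e.fst d ∩ shadow G e.fst e.snd = ∅ := by
      rw [← Set.disjoint_iff_inter_eq_empty, ← Set.subset_compl_iff_disjoint_right, hcompl]
      exact hsub
    rw [Set.inter_eq_left.2 hsub, hdisj, hν, measureReal_empty]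
    have sd : edgeSide e d = -1 := if_neg (by omega)
    have ld : edgeDist e d = G.dist e.fst c + 1 := by unfold edgeDist; omega
    have sc : edgeSide e c = -1 := if_neg (by omega)
    have lc : edgeDist e c = G.dist e.fst c := by unfold edgeDist; omega
    rw [edgePotential, edgePotential, sd, ld, sc, lc, inv_pow, inv_pow]
    field_simp
    ring

theorem poissonFun_busemann (h : IsRegularTree G q) (x y : V) (e : G.Dart) :
    poissonFun h (busemann h.isTree x y) e =
      ((edgePotential q e y - edgePotential q e x : ℝ) : ℂ) := by
  have hT := h.isTree
  have hadj : ∀ {c d : V}, G.Adj c d → poissonFun h (busemann hT c d) e =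
      ((edgePotential q e d - edgePotential q e c : ℝ) : ℂ) := by
    intro c d hcd
    rcases hT.dist_eq_dist_add_one_of_adj e.fst hcd with hd | hd
    · have h1 := poissonFun_busemann_of_adj_of_dist h hcd.symm e hd
      have h2 : busemann hT c d = -busemann hT d c := by
        rw [eq_neg_iff_add_eq_zero, ← busemann_add, busemann_self]
      rw [h2, map_neg, Pi.neg_apply, h1, ← Complex.ofReal_neg, neg_sub]
    · exact poissonFun_busemann_of_adj_of_dist h hcd e hd
  obtain ⟨p⟩ := hT.connected x y
  induction p with
  | nil => rw [busemann_self, map_zero]; simp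
  | cons hcd p ih =>
    rw [busemann_add hT _ _ _, map_add, Pi.add_apply, hadj hcd, ih, ← Complex.ofReal_add]
    congr 1
    ring

theorem norm_poisson_busemannClass_sq (h : IsRegularTree G q) (x y : V) (e : G.Dart) :
    ‖poisson h (busemannClass h.isTree x y) e‖ ^ 2 =
      (edgePotential q e y - edgePotential q e x) ^ 2 := by
  have : poisson h (busemannClass h.isTree x y) e = poissonFun h (busemann h.isTree x y) e := rfl
  rw [this, poissonFun_busemann, Complex.norm_real, Real.norm_eq_abs, sq_abs]

end

/-! ### Edges that separate two vertices -/

theorem edgeSide_eq_or (e : G.Dart) (z : V) : edgeSide e z = 1 ∨ edgeSide e z = -1 := by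
  unfold edgeSide
  split_ifs <;> simp

/-- The endpoints of an edge other than `e` lie on the same side of `e`. -/
theorem eq_or_eq_symm_of_edgeSide_ne (hT : G.IsTree) (e f : G.Dart)
    (h : edgeSide e f.fst ≠ edgeSide e f.snd) : e = f ∨ e = f.symm := by
  -- An edge from the origin side of `e` to its target side is `e` itself.
  have key : ∀ {u v : V}, G.Adj u v → ¬ G.dist e.snd u < G.dist e.fst u →
      G.dist e.snd v < G.dist e.fst v → e.fst = u ∧ e.snd = v := by
    intro u v huv hu hv
    have hu' := hT.dist_eq_dist_add_one_of_adj u e.adj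
    have hv' := hT.dist_eq_dist_add_one_of_adj v e.adj
    have c1 : G.dist e.snd u = G.dist u e.snd := SimpleGraph.dist_comm
    have c2 : G.dist e.fst u = G.dist u e.fst := SimpleGraph.dist_comm
    have c3 : G.dist e.snd v = G.dist v e.snd := SimpleGraph.dist_comm
    have c4 : G.dist e.fst v = G.dist v e.fst := SimpleGraph.dist_comm
    have := dist_across hT (x := u) (y := v) _ e.adj rfl (by omega) (by omega)
    rw [dist_eq_one_iff_adj.2 huv] at this
    exact ⟨(hT.connected.dist_eq_zero_iff.1 (by omega)).symm,
      (hT.connected.dist_eq_zero_iff.1 (by omega)).symm⟩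
  unfold edgeSide at h
  split_ifs at h with h1 h2 h2
  · exact absurd rfl h
  · obtain ⟨e1, e2⟩ := key f.adj.symm h2 h1
    exact Or.inr (Dart.ext _ _ (Prod.ext e1 e2))
  · obtain ⟨e1, e2⟩ := key f.adj h1 h2
    exact Or.inl (Dart.ext _ _ (Prod.ext e1 e2))
  · exact absurd rfl h

theorem mem_darts_of_edgeSide_ne (hT : G.IsTree) (e : G.Dart) {x y : V} (p : G.Walk x y)
    (h : edgeSide e x ≠ edgeSide e y) : e ∈ p.darts ∨ e.symm ∈ p.darts := by
  induction p with
  | nil => exact absurd rfl h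
  | @cons u v w huv p ih =>
    by_cases h1 : edgeSide e u = edgeSide e v
    · rw [h1] at h
      refine (ih h).imp ?_ ?_ <;> exact fun h2 => List.mem_cons_of_mem _ h2
    · rcases eq_or_eq_symm_of_edgeSide_ne hT e ⟨(u, v), huv⟩ h1 with rfl | rfl <;> simp

theorem card_edgeSide_ne_le (hT : G.IsTree) (x y : V) (u : Finset G.Dart)
    (hu : ∀ e ∈ u, edgeSide e x ≠ edgeSide e y) : u.card ≤ 2 * G.dist x y := by
  classical
  obtain ⟨p, hp⟩ := hT.connected.exists_walk_length_eq_dist x y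
  have hsub : u ⊆ (p.darts ++ p.darts.map Dart.symm).toFinset := by
    intro e he
    rw [List.mem_toFinset, List.mem_append, List.mem_map]
    refine (mem_darts_of_edgeSide_ne hT e p (hu e he)).imp id fun h => ⟨_, h, e.symm_symm⟩
  refine (Finset.card_le_card hsub).trans ((List.toFinset_card_le _).trans ?_)
  rw [List.length_append, List.length_map, Walk.length_darts, hp]
  omega

/-- The edges of the geodesic from `x` to `y`, oriented towards `y`. -/
theorem exists_geodesic_darts (hT : G.IsTree) (x y : V) :
    ∃ f : Fin (G.dist x y) → G.Dart, Function.Injective f ∧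
      ∀ i, edgeSide (f i) x = -1 ∧ edgeSide (f i) y = 1 := by
  obtain ⟨p, hp⟩ := hT.connected.exists_walk_length_eq_dist x y
  have hx : ∀ i ≤ G.dist x y, G.dist x (p.getVert i) = i ∧
      G.dist (p.getVert i) y = G.dist x y - i := by
    intro i hi
    have h1 : G.dist x (p.getVert i) ≤ i := by
      have := dist_le (p.take i)
      rw [Walk.take_length] at this
      omega
    have h2 : G.dist (p.getVert i) y ≤ G.dist x y - i := by
      have := dist_le (p.drop i)
      rw [Walk.drop_length] at this
      omega
    have h3 := hT.connected.dist_triangle (u := x) (v := p.getVert i) (w := y)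
    omega
  refine ⟨fun i => ⟨(p.getVert i, p.getVert (i + 1)), p.adj_getVert_succ (by omega)⟩, ?_, ?_⟩
  · intro i j hij
    have : p.getVert i = p.getVert j := congrArg (fun e : G.Dart => e.fst) hij
    rw [Fin.ext_iff, ← (hx i i.2.le).1, this, (hx j j.2.le).1]
  · intro i
    have h1 := hx i i.2.le
    have h2 := hx (i + 1) i.2
    have hi := i.2
    rw [SimpleGraph.dist_comm (u := x) (v := p.getVert _)] at h1 h2
    exact ⟨if_neg (by change ¬ G.dist (p.getVert (i + 1)) x < G.dist (p.getVert i) x; omega),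
      if_pos (by change G.dist (p.getVert (i + 1)) y < G.dist (p.getVert i) y; omega)⟩

/-! ### Growth of spheres and the sum of `q ^ (-2 d(z, e))` over the edges -/

section

variable [G.LocallyFinite] {q : ℕ}

/-- The shadows of the points of a sphere about `x` are disjoint sets of equal measure. -/
theorem card_sphere_le (h : IsRegularTree G q) (x : V) (k : ℕ) (u : Finset V)
    (hu : ∀ v ∈ u, G.dist x v = k + 1) : (u.card : ℝ) ≤ (q + 1) * (q : ℝ) ^ k := by
  have hq : (2 : ℝ) ≤ q := by exact_mod_cast h.two_le
  have hdisj : (u : Set V).PairwiseDisjoint (shadow G x) := by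
    intro v hv w hw hvw
    refine Set.disjoint_left.2 fun ξ h1 h2 => hvw ?_
    obtain ⟨r, rfl, rfl⟩ := exists_ray h.isTree x ξ
    rw [r.endpoint_mem_shadow_self_iff h.isTree, hu _ hv] at h1
    rw [r.endpoint_mem_shadow_self_iff h.isTree, hu _ hw] at h2
    rw [← h1, h2]
  have h1 := measureReal_biUnion_finset (μ := visualMeasure h x) hdisj
    fun v _ => (isOpen_shadow x v).measurableSet
  rw [Finset.sum_congr rfl fun v hv => visualMeasure_real_shadow h (hu v hv), Finset.sum_const,
    nsmul_eq_mul, ← div_eq_mul_inv] at h1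
  have h2 : (u.card : ℝ) / ((q + 1) * (q : ℝ) ^ k) ≤ 1 := h1 ▸ measureReal_le_one
  rwa [div_le_one (by positivity)] at h2

theorem sum_vertices_le (h : IsRegularTree G q) (x : V) (u : Finset V) (hu : x ∉ u) :
    ∑ v ∈ u, (q : ℝ)⁻¹ ^ (2 * (G.dist x v - 1)) ≤ (q + 1) * q / (q - 1) := by
  have hq : (2 : ℝ) ≤ q := by exact_mod_cast h.two_le
  set N := u.sup (G.dist x) + 1
  have hmap : ∀ v ∈ u, G.dist x v - 1 ∈ Finset.range N := fun v hv => by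
    have := Finset.le_sup (f := G.dist x) hv
    rw [Finset.mem_range]
    omega
  have hpos : ∀ v ∈ u, 0 < G.dist x v := fun v hv =>
    h.isTree.connected.pos_dist_of_ne (by rintro rfl; exact hu hv)
  rw [← Finset.sum_fiberwise_of_maps_to hmap]
  have hk : ∀ k ∈ Finset.range N, ∑ v ∈ u with G.dist x v - 1 = k,
      (q : ℝ)⁻¹ ^ (2 * (G.dist x v - 1)) ≤ (q + 1) * (q : ℝ)⁻¹ ^ k := by
    intro k _
    rw [Finset.sum_congr rfl (g := fun _ => (q : ℝ)⁻¹ ^ (2 * k))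
      fun v hv => by rw [(Finset.mem_filter.1 hv).2], Finset.sum_const, nsmul_eq_mul]
    have hc := card_sphere_le h x k {v ∈ u | G.dist x v - 1 = k} fun v hv => by
      have := hpos v (Finset.mem_filter.1 hv).1
      have := (Finset.mem_filter.1 hv).2
      omega
    refine (mul_le_mul_of_nonneg_right hc (by positivity)).trans (le_of_eq ?_)
    rw [two_mul, pow_add, inv_pow]
    field_simp
  refine (Finset.sum_le_sum hk).trans ?_
  rw [← Finset.mul_sum, mul_div_assoc]
  refine mul_le_mul_of_nonneg_left ?_ (by positivity)
  have hr : (q : ℝ)⁻¹ < 1 := inv_lt_one_of_one_lt₀ (by linarith)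
  have h1 := (summable_geometric_of_lt_one (by positivity) hr).sum_le_tsum (Finset.range N)
    fun _ _ => by positivity
  rw [tsum_geometric_of_lt_one (by positivity) hr] at h1
  refine h1.trans (le_of_eq ?_)
  have : (q : ℝ) - 1 ≠ 0 := by linarith
  field_simp

theorem sum_darts_le (h : IsRegularTree G q) (x : V) (u : Finset G.Dart) :
    ∑ e ∈ u, (q : ℝ)⁻¹ ^ (2 * edgeDist e x) ≤ 2 * ((q + 1) * q / (q - 1)) := by
  classical
  have hT := h.isTree
  -- A dart pointing away from `x` is determined by its target.
  have key : ∀ u : Finset G.Dart, (∀ e ∈ u, G.dist x e.snd = G.dist x e.fst + 1) →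
      ∑ e ∈ u, (q : ℝ)⁻¹ ^ (2 * edgeDist e x) ≤ (q + 1) * q / (q - 1) := by
    intro u hu
    have hinj : Set.InjOn (fun e : G.Dart => e.snd) u := by
      intro e he f hf hef
      have hef : e.snd = f.snd := hef
      have hfst := eq_of_adj_of_dist hT e.adj (hef ▸ f.adj) (hu e he) (hef ▸ hu f hf)
      exact Dart.ext _ _ (Prod.ext hfst hef)
    have hx : x ∉ u.image fun e => e.snd := by
      intro hx
      obtain ⟨e, he, hex⟩ := Finset.mem_image.1 hx
      have := hu e he
      rw [hex, SimpleGraph.dist_self] at this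
      omega
    refine le_trans (le_of_eq ?_) (sum_vertices_le h x _ hx)
    rw [Finset.sum_image hinj]
    refine Finset.sum_congr rfl fun e he => ?_
    have := hu e he
    have : edgeDist e x = G.dist x e.snd - 1 := by
      rw [edgeDist, SimpleGraph.dist_comm (v := x), SimpleGraph.dist_comm (v := x)]
      omega
    rw [this]
  rw [← Finset.sum_filter_add_sum_filter_not u fun e => G.dist x e.snd = G.dist x e.fst + 1,
    two_mul]
  refine add_le_add (key _ fun e he => (Finset.mem_filter.1 he).2) ?_
  have hs := key ({e ∈ u | ¬ G.dist x e.snd = G.dist x e.fst + 1}.image Dart.symm) ?_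
  · rw [Finset.sum_image (Dart.symm_involutive.injective.injOn)] at hs
    refine le_trans (le_of_eq (Finset.sum_congr rfl fun e _ => ?_)) hs
    exact congrArg (fun n => (q : ℝ)⁻¹ ^ (2 * n)) (min_comm _ _)
  · intro e he
    obtain ⟨f, hf, rfl⟩ := Finset.mem_image.1 he
    exact (hT.dist_eq_dist_add_one_of_adj x f.adj).resolve_right (Finset.mem_filter.1 hf).2

end

/-! ### The square sum -/

theorem four_le_sq_edgePotential_sub {q : ℕ} (hq : 2 ≤ q) (e : G.Dart) {x y : V}
    (hx : edgeSide e x = -1) (hy : edgeSide e y = 1) :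
    4 ≤ (edgePotential q e y - edgePotential q e x) ^ 2 := by
  have hq : (2 : ℝ) ≤ q := by exact_mod_cast hq
  have hr : (q : ℝ)⁻¹ ≤ 1 := inv_le_one_of_one_le₀ (by linarith)
  have h1 : (q : ℝ)⁻¹ ^ edgeDist e x ≤ 1 := pow_le_one₀ (by positivity) hr
  have h2 : (q : ℝ)⁻¹ ^ edgeDist e y ≤ 1 := pow_le_one₀ (by positivity) hr
  have : 2 ≤ edgePotential q e y - edgePotential q e x := by
    rw [edgePotential, edgePotential, hx, hy, one_mul, neg_one_mul, sub_neg_eq_add, ← add_div,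
      le_div_iff₀ (by linarith)]
    linarith
  nlinarith

theorem sq_edgePotential_sub_le {q : ℕ} (hq : 2 ≤ q) (e : G.Dart) (x y : V) :
    (edgePotential q e y - edgePotential q e x) ^ 2 ≤
      (if edgeSide e x ≠ edgeSide e y then 4 * ((q : ℝ) + 1) ^ 2 / (q - 1) ^ 2 else 0) +
        4 / (q - 1) ^ 2 *
          ((q : ℝ)⁻¹ ^ (2 * edgeDist e x) + (q : ℝ)⁻¹ ^ (2 * edgeDist e y)) := by
  have hq : (2 : ℝ) ≤ q := by exact_mod_cast hq
  have hr : (q : ℝ)⁻¹ ≤ 1 := inv_le_one_of_one_le₀ (by linarith)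
  have hq1 : 0 < (q : ℝ) - 1 := by linarith
  rw [edgePotential, edgePotential, pow_mul', pow_mul']
  have a1 : (q : ℝ)⁻¹ ^ edgeDist e x ≤ 1 := pow_le_one₀ (by positivity) hr
  have b1 : (q : ℝ)⁻¹ ^ edgeDist e y ≤ 1 := pow_le_one₀ (by positivity) hr
  have a0 : 0 ≤ (q : ℝ)⁻¹ ^ edgeDist e x := by positivity
  have b0 : 0 ≤ (q : ℝ)⁻¹ ^ edgeDist e y := by positivity
  generalize (q : ℝ)⁻¹ ^ edgeDist e x = A at *
  generalize (q : ℝ)⁻¹ ^ edgeDist e y = B at *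
  rw [← mul_div_assoc, ← mul_div_assoc, ← sub_div, div_pow, div_mul_eq_mul_div]
  have hc : ∀ c : ℝ, c ^ 2 = 1 →
      (c * (q + 1 - 2 * B) - c * (q + 1 - 2 * A)) ^ 2 ≤ 4 * (A ^ 2 + B ^ 2) := by
    intro c hc
    have : (c * (q + 1 - 2 * B) - c * (q + 1 - 2 * A)) ^ 2 = c ^ 2 * (4 * (A - B) ^ 2) := by ring
    rw [this, hc]
    nlinarith [mul_nonneg a0 b0]
  by_cases hs : edgeSide e x = edgeSide e y
  · rw [if_neg (not_not.2 hs), zero_add, hs]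
    refine div_le_div_of_nonneg_right (hc _ ?_) (by positivity)
    rcases edgeSide_eq_or e y with h | h <;> rw [h] <;> norm_num
  · rw [if_pos hs, ← add_div]
    refine div_le_div_of_nonneg_right ?_ (by positivity)
    have hab : 4 * ((q : ℝ) + 1 - A - B) ^ 2 ≤ 4 * (q + 1) ^ 2 + 4 * (A ^ 2 + B ^ 2) := by
      have : ((q : ℝ) + 1 - A - B) ^ 2 ≤ (q + 1) ^ 2 :=
        pow_le_pow_left₀ (by linarith) (by linarith) 2
      nlinarith [sq_nonneg A, sq_nonneg B]
    refine le_trans (le_of_eq ?_) hab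
    rcases edgeSide_eq_or e x with hx | hx <;> rcases edgeSide_eq_or e y with hy | hy
    · exact absurd (hx.trans hy.symm) hs
    · rw [hx, hy]; ring
    · rw [hx, hy]; ring
    · exact absurd (hx.trans hy.symm) hs

section

variable [G.LocallyFinite] {q : ℕ}

theorem sum_norm_sq_poisson_le (h : IsRegularTree G q) (x y : V) (u : Finset G.Dart) :
    ∑ e ∈ u, ‖poisson h (busemannClass h.isTree x y) e‖ ^ 2 ≤
      8 * ((q : ℝ) + 1) ^ 2 / (q - 1) ^ 2 * G.dist x y +
        16 * (q : ℝ) * (q + 1) / (q - 1) ^ 3 := by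
  classical
  have hq : (2 : ℝ) ≤ q := by exact_mod_cast h.two_le
  have hq1 : 0 < (q : ℝ) - 1 := by linarith
  have hcard : (({e ∈ u | edgeSide e x ≠ edgeSide e y}.card : ℕ) : ℝ) ≤ 2 * G.dist x y := by
    exact_mod_cast card_edgeSide_ne_le h.isTree x y _ fun e he => (Finset.mem_filter.1 he).2
  simp_rw [norm_poisson_busemannClass_sq]
  refine (Finset.sum_le_sum fun e _ => sq_edgePotential_sub_le h.two_le e x y).trans ?_
  rw [Finset.sum_add_distrib, ← Finset.sum_filter, Finset.sum_const, nsmul_eq_mul,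
    ← Finset.mul_sum, Finset.sum_add_distrib]
  refine add_le_add ((mul_le_mul_of_nonneg_right hcard (by positivity)).trans (le_of_eq ?_))
    ((mul_le_mul_of_nonneg_left (add_le_add (sum_darts_le h x u) (sum_darts_le h y u))
      (by positivity)).trans (le_of_eq ?_))
  · ring
  · field_simp
    ring

theorem summable_norm_sq_poisson (h : IsRegularTree G q) (x y : V) :
    Summable fun e => ‖poisson h (busemannClass h.isTree x y) e‖ ^ 2 :=
  summable_of_sum_le (fun _ => sq_nonneg _) (sum_norm_sq_poisson_le h x y)

theorem four_mul_dist_le_tsum (h : IsRegularTree G q) (x y : V) :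
    4 * (G.dist x y : ℝ) ≤ ∑' e, ‖poisson h (busemannClass h.isTree x y) e‖ ^ 2 := by
  classical
  obtain ⟨f, hf, hs⟩ := exists_geodesic_darts h.isTree x y
  refine le_trans ?_ ((summable_norm_sq_poisson h x y).sum_le_tsum
    (Finset.univ.image f) fun _ _ => sq_nonneg _)
  rw [Finset.sum_image hf.injOn]
  have : ∀ i ∈ Finset.univ, 4 ≤ ‖poisson h (busemannClass h.isTree x y) (f i)‖ ^ 2 := by
    intro i _
    rw [norm_poisson_busemannClass_sq]
    exact four_le_sq_edgePotential_sub h.two_le _ (hs i).1 (hs i).2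
  refine le_trans (le_of_eq ?_) (Finset.card_nsmul_le_sum _ _ _ this)
  rw [Finset.card_univ, Fintype.card_fin, nsmul_eq_mul, mul_comm]

theorem memlp_poisson_busemannClass (h : IsRegularTree G q) (x y : V) :
    Memℓp (poisson h (busemannClass h.isTree x y)) 2 := by
  rw [memℓp_gen_iff (by norm_num)]
  simpa using summable_norm_sq_poisson h x y

end

end RegularTree

theorem theorem1p1 (q : ℕ) (hq : 2 ≤ q) :
    ∃ C K : ℝ, 0 < C ∧ 0 < K ∧
      C = 8 * ((q : ℝ) + 1) ^ 2 / ((q : ℝ) - 1) ^ 2 ∧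
      K = 16 * (q : ℝ) ^ 2 * (2 * (q : ℝ) + 1) / (((q : ℝ) - 1) ^ 3 * ((q : ℝ) + 1)) ∧
      ∀ {V : Type*} (G : SimpleGraph V) [G.LocallyFinite] (hG : G.IsTree)
        (hreg : G.IsRegularOfDegree (q + 1)) (x y : V),
        ∃ hmem : Memℓp (RegularTree.poisson ⟨hq, hG, hreg⟩ (RegularTree.busemannClass hG x y)) 2,
          4 * (G.dist x y : ℝ) ≤ ‖(⟨_, hmem⟩ : lp (fun _ : G.Dart => ℂ) 2)‖ ^ 2 ∧
          ‖(⟨_, hmem⟩ : lp (fun _ : G.Dart => ℂ) 2)‖ ^ 2 ≤ C * (G.dist x y : ℝ) + K := by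
  have hq' : (2 : ℝ) ≤ q := by exact_mod_cast hq
  have hq1 : 0 < (q : ℝ) - 1 := by linarith
  refine ⟨_, _, by positivity, by positivity, rfl, rfl, ?_⟩
  intro V G _ hG hreg x y
  have h : RegularTree.IsRegularTree G q := ⟨hq, hG, hreg⟩
  have hmem := RegularTree.memlp_poisson_busemannClass h x y
  have hnorm : ‖(⟨_, hmem⟩ : lp (fun _ : G.Dart => ℂ) 2)‖ ^ 2 =
      ∑' e, ‖RegularTree.poisson h (RegularTree.busemannClass hG x y) e‖ ^ 2 := by
    simpa using lp.norm_rpow_eq_tsum (p := 2) (by norm_num)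
      (⟨_, hmem⟩ : lp (fun _ : G.Dart => ℂ) 2)
  refine ⟨hmem, ?_, ?_⟩
  · rw [hnorm]
    exact RegularTree.four_mul_dist_le_tsum h x y
  · rw [hnorm]
    refine (Real.tsum_le_of_sum_le (fun _ => sq_nonneg _)
      (RegularTree.sum_norm_sq_poisson_le h x y)).trans (add_le_add le_rfl ?_)
    -- After clearing denominators this is `(q + 1) ^ 2 ≤ q * (2 * q + 1)`, true since `q ≥ 2`.
    rw [div_le_div_iff₀ (by positivity) (by positivity)]
    have h1 : ((q : ℝ) + 1) ^ 2 ≤ q * (2 * q + 1) := by nlinarith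
    have h2 := mul_le_mul_of_nonneg_left h1
      (show (0 : ℝ) ≤ 16 * q * (q - 1) ^ 3 by positivity)
    linarith
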